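/- For a finite group $G$, let $\mathrm{cp}(G)=|\{(x,y)\in G\times G : xy=yx\}|/|G|^2$ be its commuting probability, and let $\mathrm{Rad}(G)$ be its solvable radical, i.e. the largest solvable normal subgroup of $G$. For finite groups $G$, $\mathrm{cp}(G)\to 0$ as $[G:\mathrm{Rad}(G)]\to\infty$. That is, for every real $\varepsilon>0$ there is a natural number $N$ such that every finite group $G$ with $[G:\mathrm{Rad}(G)]\geq N$ satisfies $\mathrm{cp}(G)<\varepsilon$. Equivalently, for every real $\rho>0$ there is a natural number $B$ such that every finite group $G$ with $\mathrm{cp}(G)\geq\rho$ satisfies $[G:\mathrm{Rad}(G)]\leq B$. -/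

import Mathlib

universe u

/-- The solvable radical `Rad(G)`: the subgroup of `G` generated by all solvable normal subgroups
of `G`.  For finite `G` it is the largest solvable normal subgroup of `G`, see
`solvableRadical_isGreatest`. -/
def solvableRadical (G : Type*) [Group G] : Subgroup G :=
  sSup {N : Subgroup G | N.Normal ∧ Group.IsSolvable N}

theorem normal_isSolvable_sup {G : Type*} [Group G] {H K : Subgroup G}
    (hH : H.Normal ∧ Group.IsSolvable H) (hK : K.Normal ∧ Group.IsSolvable K) :
    (H ⊔ K).Normal ∧ Group.IsSolvable (H ⊔ K : Subgroup G) := by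
  obtain ⟨hHn, hHs⟩ := hH
  obtain ⟨hKn, hKs⟩ := hK
  refine ⟨inferInstance, ?_⟩
  have hq : Group.IsSolvable (H ⧸ (K.subgroupOf H)) := inferInstance
  have e : H ⧸ (K.subgroupOf H) ≃* _ := QuotientGroup.quotientInfEquivProdNormalQuotient H K
  have hq' := Group.isSolvable_of_surjective (f := e.toMonoidHom) e.surjective
  have hk : Group.IsSolvable (K.subgroupOf (H ⊔ K)) :=
    Group.isSolvable_of_isSolvable_injective
      (f := (Subgroup.subgroupOfEquivOfLe (le_sup_right : K ≤ H ⊔ K)).toMonoidHom)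
      (Subgroup.subgroupOfEquivOfLe (le_sup_right : K ≤ H ⊔ K)).injective
  exact (Group.isSolvable_iff_subgroup_quotient (K.subgroupOf (H ⊔ K))).2 ⟨hk, hq'⟩

theorem solvableRadical_isGreatest (G : Type*) [Group G] [Finite G] :
    IsGreatest {N : Subgroup G | N.Normal ∧ Group.IsSolvable N} (solvableRadical G) := by
  refine ⟨?_, fun N hN => le_sSup hN⟩
  have hfin : {N : Subgroup G | N.Normal ∧ Group.IsSolvable N}.Finite := Set.toFinite _
  have hbot : (⊥ : Subgroup G) ∈ {N : Subgroup G | N.Normal ∧ Group.IsSolvable N} :=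
    ⟨inferInstance, inferInstance⟩
  have key := Finset.sup_induction (s := hfin.toFinset) (f := id)
    (p := fun N : Subgroup G => N.Normal ∧ Group.IsSolvable N) hbot
    (fun _ h₁ _ h₂ => normal_isSolvable_sup h₁ h₂) (fun N hN => by simpa using hN)
  rw [Finset.sup_id_eq_sSup, Set.Finite.coe_toFinset] at key
  exact key

open Subgroup

/-! If commuting pairs have density at least `ρ`, a positive proportion of elements have boundedly
many conjugates. Class sizes are submultiplicative, so products of such elements still have small
classes. Since the sets of these products cannot keep growing, one of them is a subgroup `H` of
bounded index, and all classes of `H` are bounded. By P. M. Neumann's argument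
(`exists_isSolvable_index_le`), `H` has a subgroup of class at most two and bounded index; its
normal core in `G` lies in the radical. -/

theorem index_centralizer_mul_le {G : Type*} [Group G] [Finite G] (x y : G) :
    (centralizer {x * y}).index ≤ (centralizer {x}).index * (centralizer {y}).index := by
  refine (index_antitone (H := centralizer {x} ⊓ centralizer {y}) fun g hg => ?_).trans index_inf_le
  have hx : Commute g x := mem_centralizer_singleton_iff.1 hg.1
  have hy : Commute g y := mem_centralizer_singleton_iff.1 hg.2
  exact mem_centralizer_singleton_iff.2 (hx.mul_right hy).eq

theorem centralizer_singleton_inv {G : Type*} [Group G] (x : G) :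
    centralizer {x⁻¹} = centralizer {x} := by
  ext g
  simp only [mem_centralizer_singleton_iff]
  exact Commute.inv_right_iff (a := g) (b := x)

theorem isSolvable_of_commutator_le_center {G : Type*} [Group G]
    (h : commutator G ≤ center G) : Group.IsSolvable G := by
  refine ⟨⟨2, ?_⟩⟩
  rw [derivedSeries_succ, derivedSeries_one, commutator_eq_bot_iff_le_centralizer]
  exact h.trans (center_le_centralizer _)

/-- A finite group in which all conjugacy classes have size at most `m` has a solvable subgroup
(of nilpotency class at most two) of index bounded in terms of `m`. -/
theorem exists_isSolvable_index_le {G : Type*} [Group G] [Finite G] {m : ℕ}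
    (hm : ∀ g : G, (centralizer {g}).index ≤ m) :
    ∃ C : Subgroup G, Group.IsSolvable C ∧ C.index ≤ m ^ m * m ^ (m * m) := by
  classical
  have hm0 : 1 ≤ m := (Nat.one_le_iff_ne_zero.2 index_ne_zero_of_finite).trans (hm 1)
  -- A largest class: for `u` in `U`, the class of `u * a` cannot exceed it, which forces the
  -- transversal `b` of `centralizer {a}` to be one for `centralizer {u * a}` too.
  obtain ⟨a, ha⟩ := Finite.exists_max fun g : G => (centralizer {g}).index
  let Q := G ⧸ centralizer {a}
  have : Fintype Q := Fintype.ofFinite Q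
  have hQ : Fintype.card Q ≤ m := by
    rw [← Nat.card_eq_fintype_card]; exact hm a
  let b : Q → G := Quotient.out
  have hb (q : Q) : (b q : Q) = q := Quotient.out_eq q
  let U : Subgroup G := ⨅ q, centralizer {b q}
  have hU : U.index ≤ m ^ m := by
    refine (index_iInf_le _).trans ((Finset.prod_le_pow_card _ _ m fun q _ => hm _).trans ?_)
    exact Nat.pow_le_pow_right hm0 hQ
  have hUb {u : G} (hu : u ∈ U) (q : Q) : Commute u (b q) :=
    mem_centralizer_singleton_iff.1 (mem_iInf.1 hu q)
  let s : Q × Q → G := fun p => (b p.1 * a * (b p.1)⁻¹) * (b p.2 * a * (b p.2)⁻¹)⁻¹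
  let V : Subgroup G := ⨅ p, centralizer {s p}
  have hV : V.index ≤ m ^ (m * m) := by
    refine (index_iInf_le _).trans ((Finset.prod_le_pow_card _ _ m fun q _ => hm _).trans ?_)
    refine Nat.pow_le_pow_right hm0 ?_
    rw [Finset.card_univ, Fintype.card_prod]
    exact Nat.mul_le_mul hQ hQ
  have conj_eq (g h x : G) (hgh : g⁻¹ * h ∈ centralizer {x}) : h * x * h⁻¹ = g * x * g⁻¹ := by
    rw [mem_centralizer_singleton_iff] at hgh
    calc h * x * h⁻¹ = g * ((g⁻¹ * h) * x) * h⁻¹ := by group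
      _ = g * x * g⁻¹ := by rw [hgh]; group
  -- Commutators of `U` with all of `G` take at most `m * m` values, all of the form `s p`;
  -- centralizing these values is the purpose of `V`.
  have key {u : G} (hu : u ∈ U) (h : G) : ∃ p, u⁻¹ * h * u * h⁻¹ = s p := by
    let f : Q → G ⧸ centralizer {u * a} := fun q => (b q : G ⧸ centralizer {u * a})
    have hf : Function.Injective f := by
      intro p q hpq
      have h1 : Commute ((b p)⁻¹ * b q) (u * a) :=
        mem_centralizer_singleton_iff.1 (QuotientGroup.eq.1 hpq)
      have h2 : Commute ((b p)⁻¹ * b q) u :=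
        ((hUb hu p).symm.inv_left).mul_left (hUb hu q).symm
      have h3 : Commute ((b p)⁻¹ * b q) a := by
        simpa using h2.inv_right.mul_right h1
      rw [← hb p, ← hb q]
      exact QuotientGroup.eq.2 (mem_centralizer_singleton_iff.2 h3)
    have hf' : Function.Surjective f :=
      (hf.bijective_of_nat_card_le (ha (u * a))).2
    obtain ⟨p, hp⟩ := hf' (h : G ⧸ centralizer {u * a})
    have e1 := conj_eq _ _ _ (QuotientGroup.eq.1 hp)
    have e2 := conj_eq _ _ _ (QuotientGroup.eq.1 (hb (h : Q)))
    refine ⟨(p, (h : Q)), ?_⟩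
    have e3 : b p * (u * a) * (b p)⁻¹ = u * (b p * a * (b p)⁻¹) := by
      rw [← mul_assoc, ← (hUb hu p).eq]; group
    rw [e3] at e1
    simp only [s]
    rw [← e2, eq_inv_mul_of_mul_eq e1.symm]
    group
  refine ⟨U ⊓ V, isSolvable_of_commutator_le_center ?_, index_inf_le.trans (Nat.mul_le_mul hU hV)⟩
  rw [commutator_def, commutator_le]
  rintro ⟨x, hx⟩ - ⟨y, hy⟩ -
  rw [mem_center_iff]
  rintro ⟨z, hz⟩
  obtain ⟨p, hp⟩ := key (inv_mem hx.1) y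
  have hzs : z * s p = s p * z := mem_centralizer_singleton_iff.1 (mem_iInf.1 hz.2 p)
  rw [← hp, inv_inv] at hzs
  exact Subtype.ext hzs

/-- The number of elements with few conjugates in a finite group with many commuting pairs. -/
theorem card_le_mul_ncard_index_centralizer_le {G : Type*} [Group G] [Finite G] {k : ℕ}
    (hk : 2 * Nat.card G ^ 2 ≤ k * Nat.card {p : G × G // Commute p.1 p.2}) :
    Nat.card G ≤ k * {x : G | (centralizer {x}).index ≤ k}.ncard := by
  classical
  have := Fintype.ofFinite G
  have hcard : Nat.card {p : G × G // Commute p.1 p.2} =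
      ∑ x : G, Nat.card (centralizer {x} : Subgroup G) := by
    rw [← Nat.card_sigma]
    refine Nat.card_congr
      ⟨fun p => ⟨p.1.1, p.1.2, mem_centralizer_singleton_iff.2 p.2.symm.eq⟩,
        fun p => ⟨(p.1, p.2.1), (mem_centralizer_singleton_iff.1 p.2.2).symm⟩,
        fun _ => rfl, fun _ => rfl⟩
  -- An element with more than `k` conjugates has a centralizer of order below `|G| / k`, so such
  -- elements account for at most half of the lower bound `2 * |G| ^ 2`.
  have hle (x : G) : k * Nat.card (centralizer {x} : Subgroup G) ≤
      (if (centralizer {x}).index ≤ k then k * Nat.card G else 0) + Nat.card G := by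
    have hx := (centralizer {x}).card_mul_index
    split_ifs with h
    · exact (Nat.mul_le_mul_left k (card_le_card_group _)).trans (Nat.le_add_right _ _)
    · rw [← hx, mul_comm]
      exact (Nat.mul_le_mul_left _ (not_le.1 h).le).trans (Nat.le_add_left _ _)
  have hsum := Finset.sum_le_sum fun x (_ : x ∈ Finset.univ) => hle x
  rw [← Finset.mul_sum, ← hcard, Finset.sum_add_distrib, ← Finset.sum_filter, Finset.sum_const,
    Finset.sum_const, Finset.card_univ, ← Nat.card_eq_fintype_card, smul_eq_mul,
    smul_eq_mul] at hsum
  have hX : {x : G | (centralizer {x}).index ≤ k}.ncard =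
      (Finset.univ.filter fun x : G => (centralizer {x}).index ≤ k).card := by
    rw [← Set.ncard_coe_finset]; simp
  rw [hX]
  have hpos : 0 < Nat.card G := Nat.card_pos
  refine Nat.le_of_mul_le_mul_right (c := Nat.card G) ?_ hpos
  nlinarith

/-- If a positive proportion of the elements have few conjugates, then these elements lie in a
subgroup of bounded index all of whose elements have few conjugates. -/
theorem exists_index_le_of_card_le_mul_ncard {G : Type*} [Group G] [Finite G] {k : ℕ}
    (hk : Nat.card G ≤ k * {x : G | (centralizer {x}).index ≤ k}.ncard) :
    ∃ H : Subgroup G, H.index ≤ k ∧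
      ∀ h ∈ H, (centralizer {h}).index ≤ k ^ 2 ^ (3 * k + 1) := by
  have hk0 : 1 ≤ k := by
    by_contra! h
    obtain rfl : k = 0 := by omega
    exact Nat.card_pos.ne' (by simpa using hk)
  let X : ℕ → Set G := fun j => {x | (centralizer {x}).index ≤ k ^ 2 ^ j}
  have hX0 : X 0 = {x : G | (centralizer {x}).index ≤ k} := by simp [X]
  have hmonok : Monotone fun j => k ^ 2 ^ j := fun i j hij =>
    Nat.pow_le_pow_right hk0 (Nat.pow_le_pow_right two_pos hij)
  have hmono : Monotone X := fun i j hij x hx => le_trans hx (hmonok hij)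
  have hmul {j : ℕ} {x y : G} (hx : x ∈ X j) (hy : y ∈ X j) : x * y ∈ X (j + 1) := by
    refine (index_centralizer_mul_le x y).trans ((Nat.mul_le_mul hx hy).trans_eq ?_)
    rw [← pow_add, ← two_mul, pow_succ']
  have hinv {j : ℕ} {x : G} (hx : x ∈ X j) : x⁻¹ ∈ X j := by
    simpa only [X, Set.mem_ofPred_eq, centralizer_singleton_inv] using hx
  have hone (j : ℕ) : (1 : G) ∈ X j := by
    have h1 : centralizer {(1 : G)} = ⊤ := by
      ext g; simp [mem_centralizer_singleton_iff]
    simpa [X, h1] using Nat.one_le_pow _ _ hk0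
  -- Unless the chain stabilizes, every three steps make room for a new translate of `X 0`, disjoint
  -- from what came before.
  have hgrow (n : ℕ) : (∃ j ≤ 3 * n, X (j + 2) ⊆ X (j + 1)) ∨
      (n + 1) * (X 0).ncard ≤ (X (3 * n)).ncard := by
    induction n with
    | zero => right; simp
    | succ n ih =>
      obtain ⟨j, hj, hjX⟩ | ih := ih
      · exact Or.inl ⟨j, by omega, hjX⟩
      by_cases hn : X (3 * n + 2) ⊆ X (3 * n + 1)
      · exact Or.inl ⟨3 * n, by omega, hn⟩
      right
      obtain ⟨x, hx, hx'⟩ := Set.not_subset.1 hn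
      have hdisj : Disjoint (X (3 * n)) ((fun y => x * y) '' X 0) := by
        rw [Set.disjoint_left]
        rintro _ hz ⟨y, hy, rfl⟩
        exact hx' (by simpa using hmul hz (hinv (hmono (Nat.zero_le _) hy)))
      have hsub : X (3 * n) ∪ (fun y => x * y) '' X 0 ⊆ X (3 * (n + 1)) := by
        rintro z (hz | ⟨y, hy, rfl⟩)
        · exact hmono (by omega) hz
        · exact hmul hx (hmono (Nat.zero_le _) hy)
      have hc := Set.ncard_le_ncard hsub (Set.toFinite _)
      rw [Set.ncard_union_eq hdisj (Set.toFinite _) (Set.toFinite _),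
        Set.ncard_image_of_injective _ (mul_right_injective x)] at hc
      linarith
  rw [← hX0] at hk
  obtain ⟨j, hj, hjX⟩ | h := hgrow k
  -- Products from `X (j + 1)` land in `X (j + 2)`, hence back in `X (j + 1)`; `j ≤ 3 * k` gives the
  -- exponent `3 * k + 1`.
  · let H : Subgroup G :=
      { carrier := X (j + 1)
        mul_mem' := fun hx hy => hjX (hmul hx hy)
        one_mem' := hone _
        inv_mem' := hinv }
    refine ⟨H, ?_, fun h hh => le_trans hh (hmonok (by omega))⟩
    have hc : (X 0).ncard ≤ Nat.card H :=
      Set.ncard_le_ncard (hmono (Nat.zero_le _) : X 0 ⊆ X (j + 1)) (Set.toFinite _)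
    refine Nat.le_of_mul_le_mul_right (c := Nat.card H) ?_ Nat.card_pos
    rw [index_mul_card]
    exact hk.trans (Nat.mul_le_mul_left k hc)
  -- Otherwise `(k + 1) * |X 0| ≤ |G| ≤ k * |X 0|`, impossible as `X 0` contains `1`.
  · have h1 : 0 < (X 0).ncard := (Set.ncard_pos (Set.toFinite _)).2 ⟨1, hone 0⟩
    have h2 := Set.ncard_le_card (X (3 * k))
    nlinarith

/-- The core is the kernel of the permutation action on the cosets of `H`. -/
theorem index_normalCore_le_factorial {G : Type*} [Group G] [Finite G] (H : Subgroup G) :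
    H.normalCore.index ≤ H.index.factorial := by
  rw [normalCore_eq_ker, index_ker, index_eq_card, ← Nat.card_perm]
  exact card_le_card_group _

/-- The solvable radical contains the normal core of any solvable subgroup. -/
theorem index_solvableRadical_le_factorial {G : Type*} [Group G] [Finite G] (H : Subgroup G)
    (hH : Group.IsSolvable H) : (solvableRadical G).index ≤ H.index.factorial := by
  have hN : Group.IsSolvable H.normalCore :=
    Group.isSolvable_of_isSolvable_injective (inclusion_injective H.normalCore_le)
  have hle : H.normalCore ≤ solvableRadical G := le_sSup ⟨inferInstance, hN⟩
  exact (index_antitone hle).trans (index_normalCore_le_factorial H)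

theorem index_solvableRadical_le {G : Type*} [Group G] [Finite G] {k m : ℕ}
    (hm : m = k ^ 2 ^ (3 * k + 1))
    (hk : 2 * Nat.card G ^ 2 ≤ k * Nat.card {p : G × G // Commute p.1 p.2}) :
    (solvableRadical G).index ≤ (m ^ m * m ^ (m * m) * k).factorial := by
  obtain ⟨H, hHk, hH⟩ :=
    exists_index_le_of_card_le_mul_ncard (card_le_mul_ncard_index_centralizer_le hk)
  rw [← hm] at hH
  have hHm (h : H) : (centralizer {h}).index ≤ m := by
    refine le_trans ?_ (hH h h.2)
    -- Classes can only shrink on passing from `G` to `H`.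
    have hle : (centralizer {(h : G)}).subgroupOf H ≤ centralizer {h} := fun g hg => by
      rw [mem_subgroupOf, mem_centralizer_singleton_iff] at hg
      exact mem_centralizer_singleton_iff.2 (Subtype.ext hg)
    refine (index_antitone hle).trans ?_
    rw [← relIndex_top_right (centralizer {(h : G)})]
    refine relIndex_le_of_le_right le_top ?_
    rw [relIndex_top_right]
    exact index_ne_zero_of_finite
  obtain ⟨C, hC, hCm⟩ := exists_isSolvable_index_le hHm
  refine (index_solvableRadical_le_factorial (C.map H.subtype) ?_).trans (Nat.factorial_le ?_)
  · exact Group.isSolvable_of_surjective (H.subtype.subgroupMap_surjective C)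
  · rw [index_map_subtype]
    exact Nat.mul_le_mul hCm hHk

theorem two_mul_card_sq_le_of_le_commProb {G : Type*} [Group G] [Finite G] {ρ : ℝ} (hρ : 0 < ρ)
    (h : ρ ≤ (commProb G : ℝ)) :
    2 * Nat.card G ^ 2 ≤ ⌈2 / ρ⌉₊ * Nat.card {p : G × G // Commute p.1 p.2} := by
  have hn : (0 : ℝ) < (Nat.card G : ℝ) ^ 2 := by
    have : 0 < Nat.card G := Nat.card_pos
    positivity
  rw [commProb_def] at h
  push_cast at h
  rw [le_div_iff₀ hn] at h
  have hk : 2 / ρ ≤ (⌈2 / ρ⌉₊ : ℝ) := Nat.le_ceil _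
  have hmain : 2 * (Nat.card G : ℝ) ^ 2 ≤
      (⌈2 / ρ⌉₊ : ℝ) * Nat.card {p : G × G // Commute p.1 p.2} :=
    calc 2 * (Nat.card G : ℝ) ^ 2 = 2 / ρ * (ρ * (Nat.card G : ℝ) ^ 2) := by field_simp
      _ ≤ _ := by gcongr
  exact_mod_cast hmain

theorem proposition4p1 :
    (∀ ε : ℝ, 0 < ε → ∃ N : ℕ, ∀ (G : Type u) [Group G] [Finite G],
      N ≤ (solvableRadical G).index → (commProb G : ℝ) < ε) ∧
    (∀ ρ : ℝ, 0 < ρ → ∃ B : ℕ, ∀ (G : Type u) [Group G] [Finite G],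
      ρ ≤ (commProb G : ℝ) → (solvableRadical G).index ≤ B) := by
  have bound : ∀ ρ : ℝ, 0 < ρ → ∃ B : ℕ, ∀ (G : Type u) [Group G] [Finite G],
      ρ ≤ (commProb G : ℝ) → (solvableRadical G).index ≤ B := fun ρ hρ =>
    ⟨_, fun _ _ _ h => index_solvableRadical_le rfl (two_mul_card_sq_le_of_le_commProb hρ h)⟩
  refine ⟨fun ε hε => ?_, bound⟩
  obtain ⟨B, hB⟩ := bound ε hε
  refine ⟨B + 1, fun G _ _ hG => ?_⟩
  by_contra! h
  exact absurd (hB G h) (by omega)
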